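/- Let $r\ge 2$ and $n\ge 1$ be integers and let $A=(a_{i_1,\ldots,i_r})$, $i_1,\ldots,i_r\in\{1,\ldots,n\}$, be a real cubical $r$-matrix of order $n$ that is nonnegative (all $a_{i_1,\ldots,i_r}\ge 0$) and symmetric ($a_{i_{\sigma(1)},\ldots,i_{\sigma(r)}}=a_{i_1,\ldots,i_r}$ for every permutation $\sigma$ of $\{1,\ldots,r\}$ and all indices). For a vector $\mathbf{x}$ and a real number $p\ge 1$ write $|\mathbf{x}|_p=\left(\sum_j|x_j|^p\right)^{1/p}$. Define \[ P_A(\mathbf{x}):=\sum_{i_1,\ldots,i_r}a_{i_1,\ldots,i_r}x_{i_1}\cdots x_{i_r}\quad(\mathbf{x}\in\mathbb{R}^n), \] \[ L_A(\mathbf{x}^{(1)},\ldots,\mathbf{x}^{(r)}):=\sum_{i_1,\ldots,i_r}a_{i_1,\ldots,i_r}\overline{x^{(1)}_{i_1}}\cdots\overline{x^{(r)}_{i_r}}\quad(\mathbf{x}^{(1)},\ldots,\mathbf{x}^{(r)}\in\mathbb{C}^n), \] and let the $p$-spectral radius and the spectral $p$-norm of $A$ be \[ \eta^{(p)}(A):=\max\{|P_A(\mathbf{x})|:\mathbf{x}\in\mathbb{R}^n,\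 |\mathbf{x}|_p=1\}, \] \[ \|A\|_p:=\max\{|L_A(\mathbf{x}^{(1)},\ldots,\mathbf{x}^{(r)})|:\mathbf{x}^{(1)},\ldots,\mathbf{x}^{(r)}\in\mathbb{C}^n,\ |\mathbf{x}^{(1)}|_p=\cdots=|\mathbf{x}^{(r)}|_p=1\}. \] If $p$ is a real number with $p\ge r$, then both maxima are attained and \[ \eta^{(p)}(A)=\|A\|_p . \] -/

import Mathlib

namespace Hyper

/-- An `r`-matrix of order `n 0 × ⋯ × n (r - 1)` with entries in `R`: a function on the product
of the index sets. -/
abbrev HMatrix (r : ℕ) (n : Fin r → ℕ) (R : Type) : Type := ((k : Fin r) → Fin (n k)) → R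

/-- A cubical `r`-matrix of order `n`. -/
abbrev CubicalMatrix (r n : ℕ) (R : Type) : Type := HMatrix r (fun _ => n) R

/-- The transpose of a cubical `r`-matrix by a permutation of its variables. -/
def CubicalMatrix.transpose {r n : ℕ} {R : Type} (A : CubicalMatrix r n R)
    (σ : Equiv.Perm (Fin r)) : CubicalMatrix r n R :=
  fun i => A (fun k => i (σ k))

/-- A cubical `r`-matrix is symmetric if all its transposes are identical (to itself). -/
def CubicalMatrix.IsSymmetric {r n : ℕ} {R : Type} (A : CubicalMatrix r n R) : Prop :=
  ∀ σ : Equiv.Perm (Fin r), A.transpose σ = A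

/-- A real `r`-matrix regarded as a complex one. -/
def HMatrix.toComplex {r : ℕ} {n : Fin r → ℕ} (A : HMatrix r n ℝ) : HMatrix r n ℂ :=
  fun i => (A i : ℂ)

/-- The `l^p` norm of a vector with entries in a normed field (here `ℝ` or `ℂ`). -/
noncomputable def vecNorm {𝕜 : Type} [NormedField 𝕜] {n : ℕ} (p : ℝ) (x : Fin n → 𝕜) : ℝ :=
  ‖(WithLp.toLp (ENNReal.ofReal p) x : PiLp (ENNReal.ofReal p) (fun _ : Fin n => 𝕜))‖

/-- The explicit formula for the `l^p` norm. -/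
theorem vecNorm_eq_sum {𝕜 : Type} [NormedField 𝕜] {n : ℕ} {p : ℝ} (hp : 1 ≤ p)
    (x : Fin n → 𝕜) : vecNorm p x = (∑ i, ‖x i‖ ^ p) ^ (1 / p) := by
  have h0 : 0 ≤ p := by linarith
  have h : (ENNReal.ofReal p).toReal = p := ENNReal.toReal_ofReal h0
  rw [vecNorm, PiLp.norm_eq_sum (by rw [h]; linarith), h]

/-- The linear form `L_A`, a function of `r` complex vectors. -/
noncomputable def linearForm {r : ℕ} {n : Fin r → ℕ} (A : HMatrix r n ℂ)
    (x : (k : Fin r) → Fin (n k) → ℂ) : ℂ :=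
  ∑ i : (k : Fin r) → Fin (n k), A i * ∏ k, starRingEnd ℂ (x k (i k))

/-- The polynomial form `P_A` of a real cubical matrix, a function of one real vector. -/
noncomputable def polyForm {r n : ℕ} (A : CubicalMatrix r n ℝ) (x : Fin n → ℝ) : ℝ :=
  ∑ i : Fin r → Fin n, A i * ∏ k, x (i k)

/-- `P_A(x) = L_A(x, …, x)` for real vectors `x`. -/
theorem linearForm_diag {r n : ℕ} (A : CubicalMatrix r n ℝ) (x : Fin n → ℝ) :
    linearForm A.toComplex (fun _ j => (x j : ℂ)) = (polyForm A x : ℂ) := by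
  simp [linearForm, polyForm, HMatrix.toComplex]

/-- The values `|L_A(x⁽¹⁾, …, x⁽ʳ⁾)|` over complex vectors with `|x⁽ᵏ⁾|_p = 1` for all `k`. -/
def normValues {r : ℕ} {n : Fin r → ℕ} (p : ℝ) (A : HMatrix r n ℂ) : Set ℝ :=
  {t | ∃ x : (k : Fin r) → Fin (n k) → ℂ, (∀ k, vecNorm p (x k) = 1) ∧ t = ‖linearForm A x‖}

/-- The spectral `p`-norm `‖A‖_p`. -/
noncomputable def spectralNorm {r : ℕ} {n : Fin r → ℕ} (p : ℝ) (A : HMatrix r n ℂ) : ℝ :=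
  sSup (normValues p A)

/-- The values `|P_A(x)|` over real vectors with `|x|_p = 1`. -/
def radiusValues {r n : ℕ} (p : ℝ) (A : CubicalMatrix r n ℝ) : Set ℝ :=
  {t | ∃ x : Fin n → ℝ, vecNorm p x = 1 ∧ t = |polyForm A x|}

/-- The `p`-spectral radius `η⁽ᵖ⁾(A)`. -/
noncomputable def spectralRadius {r n : ℕ} (p : ℝ) (A : CubicalMatrix r n ℝ) : ℝ :=
  sSup (radiusValues p A)

end Hyper

namespace Hyper

open Finset

/-! Both maxima exist by compactness of the unit spheres. Evaluating `L_A` on the diagonal gives `η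
≤ ‖A‖`. For the converse, replace entries by absolute values and average the form over the cyclic
shifts of its arguments, which symmetry permits. For each index tuple `i`, Hölder with `r ≤ p`
bounds the averaged product by `∏ k, y (i k)`, where `y` is the entrywise `p`-th power mean of the
arguments (`sum_shift_prod_le`). As `A ≥ 0`, the form is at most `P_A(y)`, and `y` is again a unit
vector (`vecNorm_powerMean`). -/

/-- The unit sphere of the `l^p` norm is compact. -/
theorem isCompact_vecNorm_eq_one {𝕜 : Type} [NormedField 𝕜] [ProperSpace 𝕜] {n : ℕ} {p : ℝ}
    (hp : 1 ≤ p) : IsCompact {x : Fin n → 𝕜 | vecNorm p x = 1} := by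
  have : Fact (1 ≤ ENNReal.ofReal p) := ⟨by simpa using hp⟩
  -- Properness is carried over from the sup norm.
  have hproper : ProperSpace (PiLp (ENNReal.ofReal p) (fun _ : Fin n => 𝕜)) :=
    (PiLp.antilipschitzWith_toLp (ENNReal.ofReal p) (fun _ : Fin n => 𝕜)).properSpace
      (PiLp.continuous_toLp _ _) (WithLp.toLp_surjective _)
  have h := (isCompact_sphere (0 : PiLp (ENNReal.ofReal p) (fun _ : Fin n => 𝕜)) 1).image
    (PiLp.continuous_ofLp (ENNReal.ofReal p) (fun _ : Fin n => 𝕜))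
  convert h using 1
  ext x
  simp only [Set.mem_ofPred_eq, Set.mem_image, mem_sphere_zero_iff_norm]
  constructor
  · intro hx
    exact ⟨WithLp.toLp _ x, hx, rfl⟩
  · rintro ⟨y, hy, rfl⟩
    exact hy

theorem vecNorm_eq_one_iff {𝕜 : Type} [NormedField 𝕜] {n : ℕ} {p : ℝ} (hp : 1 ≤ p)
    (x : Fin n → 𝕜) : vecNorm p x = 1 ↔ ∑ i, ‖x i‖ ^ p = 1 := by
  rw [vecNorm_eq_sum hp, ← Real.rpow_left_inj (Finset.sum_nonneg fun i _ => by positivity)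
    zero_le_one (show 1 / p ≠ 0 by positivity), Real.one_rpow]

theorem exists_vecNorm_eq_one {𝕜 : Type} [NormedField 𝕜] {n : ℕ} (hn : 1 ≤ n) {p : ℝ}
    (hp : 1 ≤ p) : ∃ x : Fin n → 𝕜, vecNorm p x = 1 := by
  refine ⟨Pi.single ⟨0, hn⟩ 1, ?_⟩
  rw [vecNorm_eq_one_iff hp, Finset.sum_eq_single ⟨0, hn⟩]
  · simp
  · intro b _ hb
    rw [Pi.single_eq_of_ne hb, norm_zero, Real.zero_rpow (by linarith)]
  · simp

theorem isGreatest_spectralRadius {r n : ℕ} (hn : 1 ≤ n) {p : ℝ} (hp : 1 ≤ p)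
    (A : CubicalMatrix r n ℝ) : IsGreatest (radiusValues p A) (spectralRadius p A) := by
  have himage : radiusValues p A = (fun x => |polyForm A x|) '' {x | vecNorm p x = 1} := by
    ext t
    simp [radiusValues, eq_comm]
  have hcompact : IsCompact (radiusValues p A) := by
    rw [himage]
    refine (isCompact_vecNorm_eq_one hp).image ?_
    unfold polyForm
    fun_prop
  obtain ⟨x, hx⟩ := exists_vecNorm_eq_one (𝕜 := ℝ) hn hp
  exact hcompact.isGreatest_sSup ⟨_, x, hx, rfl⟩

theorem isGreatest_spectralNorm {r : ℕ} {n : Fin r → ℕ} (hn : ∀ k, 1 ≤ n k) {p : ℝ} (hp : 1 ≤ p)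
    (A : HMatrix r n ℂ) : IsGreatest (normValues p A) (spectralNorm p A) := by
  have himage : normValues p A = (fun x => ‖linearForm A x‖) ''
      Set.pi Set.univ (fun k => {x : Fin (n k) → ℂ | vecNorm p x = 1}) := by
    ext t
    simp [normValues, eq_comm]
  have hcompact : IsCompact (normValues p A) := by
    rw [himage]
    refine (isCompact_univ_pi fun k => isCompact_vecNorm_eq_one hp).image ?_
    unfold linearForm
    refine continuous_norm.comp (continuous_finsetSum _ fun i _ => continuous_const.mul
      (continuous_finsetProd _ fun k _ => Complex.continuous_conj.comp ?_))
    fun_prop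
  choose x hx using fun k => exists_vecNorm_eq_one (𝕜 := ℂ) (hn k) hp
  exact hcompact.isGreatest_sSup ⟨_, x, hx, rfl⟩

/-- A product of `r ≤ p` nonnegative numbers is at most an affine combination of their
`p`-th powers and `1`. -/
theorem prod_le_sum_rpow {r : ℕ} {p : ℝ} (hp : 0 < p) (hrp : (r : ℝ) ≤ p) (t : Fin r → ℝ)
    (ht : ∀ k, 0 ≤ t k) : ∏ k, t k ≤ (1 - r / p) + p⁻¹ * ∑ k, t k ^ p := by
  -- Weighted AM-GM: each `t k ^ p` has weight `1/p`, and the extra point `none`, with value `1`,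
  -- absorbs the remaining weight `1 - r/p ≥ 0`.
  have hamgm := Real.geom_mean_le_arith_mean_weighted (univ : Finset (Option (Fin r)))
    (fun o => o.elim (1 - r / p) fun _ => p⁻¹) (fun o => o.elim 1 fun k => t k ^ p)
    (by
      rintro (_ | k) _
      · simpa using (div_le_one hp).2 hrp
      · simpa using hp.le)
    (by simp [Fintype.sum_option]; field_simp; ring)
    (by
      rintro (_ | k) _
      · simp
      · exact Real.rpow_nonneg (ht k) _)
  simpa [Fintype.sum_option, Fintype.prod_option, Real.rpow_rpow_inv (ht _) hp.ne',
    Finset.mul_sum] using hamgm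

/-- Hölder's inequality for the average over the cyclic shifts of the columns of a
nonnegative square array. -/
theorem sum_shift_prod_le {r : ℕ} [NeZero r] {p : ℝ} (hrp : (r : ℝ) ≤ p)
    (f : Fin r → Fin r → ℝ) (hf : ∀ k l, 0 ≤ f k l) :
    ∑ s, ∏ k, f k (k + s) ≤ r * ∏ k, ((r : ℝ)⁻¹ * ∑ l, f k l ^ p) ^ p⁻¹ := by
  have hr : (0 : ℝ) < r := by exact_mod_cast Nat.pos_of_neZero r
  have hp : 0 < p := hr.trans_le hrp
  set y : Fin r → ℝ := fun k => ((r : ℝ)⁻¹ * ∑ l, f k l ^ p) ^ p⁻¹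
  have hsum0 : ∀ k, 0 ≤ ∑ l, f k l ^ p := fun k =>
    Finset.sum_nonneg fun l _ => Real.rpow_nonneg (hf k l) _
  have hy0 : ∀ k, 0 ≤ y k := fun k => Real.rpow_nonneg (mul_nonneg (by positivity) (hsum0 k)) _
  have hyp : ∀ k, y k ^ p = (r : ℝ)⁻¹ * ∑ l, f k l ^ p := fun k =>
    Real.rpow_inv_rpow (mul_nonneg (by positivity) (hsum0 k)) hp.ne'
  -- Rows will be normalised by `y k`; if some `y k` vanishes, so does its row, and the left side is
  -- zero.
  by_cases hzero : ∃ k, y k = 0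
  · obtain ⟨k, hk⟩ := hzero
    have hs : ∑ l, f k l ^ p = 0 := by
      have := hyp k
      rw [hk, Real.zero_rpow hp.ne'] at this
      simpa [hr.ne'] using this.symm
    have hfk : ∀ l, f k l = 0 := fun l =>
      (Real.rpow_eq_zero (hf k l) hp.ne').1
        ((Finset.sum_eq_zero_iff_of_nonneg fun l _ => Real.rpow_nonneg (hf k l) _).1 hs l
          (mem_univ l))
    refine (Finset.sum_eq_zero fun s _ => Finset.prod_eq_zero (mem_univ k) (hfk (k + s))).trans_le ?_
    exact mul_nonneg hr.le (Finset.prod_nonneg fun k _ => hy0 k)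
  · push Not at hzero
    have hypos : ∀ k, 0 < y k := fun k => (hy0 k).lt_of_ne' (hzero k)
    have hprod : 0 < ∏ k, y k := Finset.prod_pos fun k _ => hypos k
    rw [← div_le_iff₀ hprod, Finset.sum_div]
    have hrow : ∀ k, ∑ s, (f k (k + s) / y k) ^ p = r := by
      intro k
      -- For fixed `k`, the shifts `k + s` run once through the whole row.
      refine (Equiv.sum_comp (Equiv.addLeft k) fun l => (f k l / y k) ^ p).trans ?_
      simp_rw [Real.div_rpow (hf k _) (hy0 k)]
      rw [← Finset.sum_div, hyp k]
      have : ∑ l, f k l ^ p ≠ 0 := by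
        intro h
        have h2 := hyp k
        rw [h, mul_zero, Real.rpow_eq_zero (hy0 k) hp.ne'] at h2
        exact hzero k h2
      field_simp
    calc ∑ s, (∏ k, f k (k + s)) / ∏ k, y k
        = ∑ s, ∏ k, f k (k + s) / y k := by simp_rw [Finset.prod_div_distrib]
      _ ≤ ∑ s : Fin r, ((1 - r / p) + p⁻¹ * ∑ k, (f k (k + s) / y k) ^ p) :=
          Finset.sum_le_sum fun s _ => prod_le_sum_rpow hp hrp _ fun k =>
            div_nonneg (hf _ _) (hy0 k)
      -- The total is `r * (1 - r/p) + p⁻¹ * (r * r)`.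
      _ = r := by
          rw [Finset.sum_add_distrib, ← Finset.mul_sum, Finset.sum_comm,
            Finset.sum_congr rfl fun k _ => hrow k]
          simp
          field_simp
          ring

/-- The multilinear form of a symmetric matrix is invariant under permuting its arguments. -/
theorem CubicalMatrix.IsSymmetric.sum_mul_prod_comp {r n : ℕ} {A : CubicalMatrix r n ℝ}
    (hA : A.IsSymmetric) (x : Fin r → Fin n → ℝ) (σ : Equiv.Perm (Fin r)) :
    ∑ i : Fin r → Fin n, A i * ∏ k, x (σ k) (i k) = ∑ i : Fin r → Fin n, A i * ∏ k, x k (i k) := by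
  -- Reindexing by `i ↦ i ∘ σ` turns `A i` into a transpose entry.
  rw [← Equiv.sum_comp (Equiv.arrowCongr σ.symm (Equiv.refl (Fin n)))]
  refine Finset.sum_congr rfl fun i _ => ?_
  congr 1
  · exact congrFun (hA σ) i
  · exact Equiv.prod_comp σ fun k => x k (i k)

/-- A nonnegative symmetric multilinear form is bounded by its polynomial form at the
`p`-th power mean of the arguments. -/
theorem CubicalMatrix.IsSymmetric.sum_mul_prod_le {r n : ℕ} [NeZero r]
    {A : CubicalMatrix r n ℝ} (hA : A.IsSymmetric) (hnonneg : ∀ i, 0 ≤ A i) {p : ℝ}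
    (hrp : (r : ℝ) ≤ p) (x : Fin r → Fin n → ℝ) (hx : ∀ k j, 0 ≤ x k j) :
    ∑ i : Fin r → Fin n, A i * ∏ k, x k (i k) ≤
      polyForm A fun j => ((r : ℝ)⁻¹ * ∑ l, x l j ^ p) ^ p⁻¹ := by
  have hr : (0 : ℝ) < r := by exact_mod_cast Nat.pos_of_neZero r
  refine le_of_mul_le_mul_left ?_ hr
  calc (r : ℝ) * ∑ i : Fin r → Fin n, A i * ∏ k, x k (i k)
      = ∑ s : Fin r, ∑ i : Fin r → Fin n, A i * ∏ k, x (k + s) (i k) := by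
        refine Eq.trans ?_
          (Finset.sum_congr rfl fun s _ => hA.sum_mul_prod_comp x (Equiv.addRight s)).symm
        simp
    _ = ∑ i : Fin r → Fin n, A i * ∑ s : Fin r, ∏ k, x (k + s) (i k) := by
        rw [Finset.sum_comm]
        simp_rw [Finset.mul_sum]
    _ ≤ ∑ i : Fin r → Fin n,
          A i * (r * ∏ k, ((r : ℝ)⁻¹ * ∑ l, x l (i k) ^ p) ^ p⁻¹) :=
        Finset.sum_le_sum fun i _ => mul_le_mul_of_nonneg_left
          (sum_shift_prod_le hrp (fun k l => x l (i k)) fun k l => hx l (i k)) (hnonneg i)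
    _ = r * polyForm A fun j => ((r : ℝ)⁻¹ * ∑ l, x l j ^ p) ^ p⁻¹ := by
        rw [polyForm, Finset.mul_sum]
        exact Finset.sum_congr rfl fun i _ => by ring

theorem norm_linearForm_toComplex_le {r : ℕ} {n : Fin r → ℕ} {A : HMatrix r n ℝ}
    (hnonneg : ∀ i, 0 ≤ A i) (x : (k : Fin r) → Fin (n k) → ℂ) :
    ‖linearForm A.toComplex x‖ ≤ ∑ i : (k : Fin r) → Fin (n k), A i * ∏ k, ‖x k (i k)‖ := by
  refine (norm_sum_le _ _).trans (Finset.sum_le_sum fun i _ => ?_)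
  simp [HMatrix.toComplex, abs_of_nonneg (hnonneg i)]

/-- The `p`-th power mean of unit vectors is a unit vector. -/
theorem vecNorm_powerMean {r n : ℕ} [NeZero r] {p : ℝ} (hp : 1 ≤ p) (x : Fin r → Fin n → ℂ)
    (hx : ∀ k, vecNorm p (x k) = 1) :
    vecNorm p (fun j => ((r : ℝ)⁻¹ * ∑ l, ‖x l j‖ ^ p) ^ p⁻¹) = 1 := by
  have hbase : ∀ j, 0 ≤ (r : ℝ)⁻¹ * ∑ l, ‖x l j‖ ^ p := fun j => by positivity
  rw [vecNorm_eq_one_iff hp]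
  simp_rw [Real.norm_of_nonneg (Real.rpow_nonneg (hbase _) _),
    Real.rpow_inv_rpow (hbase _) (by linarith : p ≠ 0)]
  rw [← Finset.mul_sum, Finset.sum_comm,
    Finset.sum_congr rfl fun k _ => (vecNorm_eq_one_iff hp (x k)).1 (hx k)]
  simp

end Hyper

/-- The first two conjuncts say that the suprema in the definitions of the two quantities are
maxima. -/
theorem theorem2 (r n : ℕ) (hr : 2 ≤ r) (hn : 1 ≤ n) (A : Hyper.CubicalMatrix r n ℝ)
    (hnonneg : ∀ i, 0 ≤ A i) (hsymm : A.IsSymmetric) (p : ℝ) (hp : (r : ℝ) ≤ p) :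
    IsGreatest (Hyper.radiusValues p A) (Hyper.spectralRadius p A) ∧
      IsGreatest (Hyper.normValues p A.toComplex) (Hyper.spectralNorm p A.toComplex) ∧
      Hyper.spectralRadius p A = Hyper.spectralNorm p A.toComplex := by
  have : NeZero r := ⟨by omega⟩
  have hp1 : 1 ≤ p := by
    have : (2 : ℝ) ≤ r := by exact_mod_cast hr
    linarith
  have hradius := Hyper.isGreatest_spectralRadius hn hp1 A
  have hnorm := Hyper.isGreatest_spectralNorm (fun _ => hn) hp1 A.toComplex
  refine ⟨hradius, hnorm, le_antisymm ?_ ?_⟩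
  · obtain ⟨x, hx, hval⟩ := hradius.1
    rw [hval]
    refine hnorm.2 ⟨fun _ j => (x j : ℂ), fun _ => ?_, ?_⟩
    · rw [Hyper.vecNorm_eq_one_iff hp1] at hx ⊢
      simpa using hx
    · rw [Hyper.linearForm_diag, Complex.norm_real, Real.norm_eq_abs]
  · obtain ⟨x, hx, hval⟩ := hnorm.1
    rw [hval]
    calc ‖Hyper.linearForm A.toComplex x‖
        ≤ ∑ i : Fin r → Fin n, A i * ∏ k, ‖x k (i k)‖ :=
          Hyper.norm_linearForm_toComplex_le hnonneg x
      _ ≤ Hyper.polyForm A fun j => ((r : ℝ)⁻¹ * ∑ l, ‖x l j‖ ^ p) ^ p⁻¹ :=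
          hsymm.sum_mul_prod_le hnonneg hp (fun k j => ‖x k j‖) fun _ _ => norm_nonneg _
      _ ≤ |Hyper.polyForm A fun j => ((r : ℝ)⁻¹ * ∑ l, ‖x l j‖ ^ p) ^ p⁻¹| := le_abs_self _
      _ ≤ Hyper.spectralRadius p A := hradius.2 ⟨_, Hyper.vecNorm_powerMean hp1 x hx, rfl⟩
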